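/- Let $n\ge 1$ and $s\in(0,1)$. Let $\phi:\mathbb{R}^n\to\mathbb{R}^n$ be a global $C^\infty$-diffeomorphism (bijective and smooth with smooth inverse), with $|J_\phi(x)|=|\det D\phi(x)|$, and let $\omega:\mathbb{R}^n\to\mathbb{C}$ be a nowhere vanishing $C^\infty$ function. Let $\mathcal{S}_{\phi,\omega}(\mathbb{R}^n)$ be the set of all $f:\mathbb{R}^n\to\mathbb{C}$ such that $(\omega f)\circ\phi^{-1}$ belongs to the classical Schwartz space $\mathcal{S}(\mathbb{R}^n)$. Put $$[\mathcal{F}_{\phi,\omega}f](\xi)=\frac{1}{(2\pi)^{n/2}}\int_{\mathbb{R}^n}e^{-i\xi\cdot\phi(x)}\,\omega(x)f(x)\,|J_\phi(x)|\,dx,\qquad [\mathcal{F}_{\phi,\omega}^{-1}F](x)=\frac{1}{\omega(x)(2\pi)^{n/2}}\int_{\mathbb{R}^n}e^{i\xi\cdot\phi(x)}F(\xi)\,d\xi,$$ and define the weighted fractional Laplacian spectrally by $(-\Delta_{\phi,\omega})^s f=\mathcal{F}_{\phi,\omega}^{-1}\big[|\xi|^{2s}[\mathcal{F}_{\phi,\omega}f](\xi)\big]$.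 Theorem (Integral Representation). For every $f\in\mathcal{S}_{\phi,\omega}(\mathbb{R}^n)$ and every $x\in\mathbb{R}^n$, $$(-\Delta_{\phi,\omega})^s f(x)=\frac{C_{n,s}}{\omega(x)}\;\mathrm{P.V.}\!\int_{\mathbb{R}^n}\frac{\omega(x)f(x)-\omega(y)f(y)}{|\phi(x)-\phi(y)|^{n+2s}}\,|J_\phi(y)|\,dy,\qquad C_{n,s}=\frac{s\,4^s\,\Gamma\!\left(\frac n2+s\right)}{\pi^{n/2}\,\Gamma(1-s)},$$ where $C_{n,s}$ is the normalization constant of the classical fractional Laplacian. Here the principal value exists: the integrand is integrable over $\{y:|x-y|>\varepsilon\}$ for each $\varepsilon>0$, and $\mathrm{P.V.}\int$ is the limit of these integrals as $\varepsilon\to0^+$. The same holds, with the same limit, for the regions $\{y:|\phi(x)-\phi(y)|>\varepsilon\}$. -/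

import Mathlib

open MeasureTheory Filter Topology
open scoped ContDiff SchwartzMap

noncomputable section

namespace WeightedFractional

variable {n : ℕ}

/-- The absolute value `|J_φ(x)| = |det Dφ(x)|` of the Jacobian determinant of `φ`. -/
def absJacobian (φ : EuclideanSpace ℝ (Fin n) → EuclideanSpace ℝ (Fin n))
    (x : EuclideanSpace ℝ (Fin n)) : ℝ :=
  |(fderiv ℝ φ x).det|

/-- The generalized Schwartz space `S_{φ,w}`: all functions `f` for which
`(w f) ∘ φ⁻¹` is a classical Schwartz function. -/
def weightedSchwartz (φ : EuclideanSpace ℝ (Fin n) ≃ EuclideanSpace ℝ (Fin n))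
    (w : EuclideanSpace ℝ (Fin n) → ℂ) : Set (EuclideanSpace ℝ (Fin n) → ℂ) :=
  {f | ∃ g : 𝓢(EuclideanSpace ℝ (Fin n), ℂ),
    (g : EuclideanSpace ℝ (Fin n) → ℂ) = (fun y => w y * f y) ∘ φ.symm}

/-- The weighted Fourier transform
`(2π)^{-n/2} ∫ e^{-i ξ · φ(x)} w(x) f(x) |J_φ(x)| dx`. -/
def weightedFourier (φ : EuclideanSpace ℝ (Fin n) → EuclideanSpace ℝ (Fin n))
    (w f : EuclideanSpace ℝ (Fin n) → ℂ) (ξ : EuclideanSpace ℝ (Fin n)) : ℂ :=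
  1 / (((2 * Real.pi) ^ ((n : ℝ) / 2) : ℝ) : ℂ) *
    ∫ x, Complex.exp (-Complex.I * ((inner ℝ ξ (φ x) : ℝ) : ℂ)) * w x * f x *
      ((absJacobian φ x : ℝ) : ℂ)

/-- The inverse weighted Fourier transform
`w(x)⁻¹ (2π)^{-n/2} ∫ e^{i ξ · φ(x)} F(ξ) dξ`. -/
def weightedFourierInv (φ : EuclideanSpace ℝ (Fin n) → EuclideanSpace ℝ (Fin n))
    (w F : EuclideanSpace ℝ (Fin n) → ℂ) (x : EuclideanSpace ℝ (Fin n)) : ℂ :=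
  1 / (w x * (((2 * Real.pi) ^ ((n : ℝ) / 2) : ℝ) : ℂ)) *
    ∫ ξ, Complex.exp (Complex.I * ((inner ℝ ξ (φ x) : ℝ) : ℂ)) * F ξ

/-- The weighted fractional Laplacian `(-Δ_{φ,w})^s`, defined spectrally as the
operator with symbol `|ξ|^{2s}` under the weighted Fourier transform. -/
def weightedFracLaplacian (s : ℝ) (φ : EuclideanSpace ℝ (Fin n) → EuclideanSpace ℝ (Fin n))
    (w f : EuclideanSpace ℝ (Fin n) → ℂ) : EuclideanSpace ℝ (Fin n) → ℂ :=
  weightedFourierInv φ w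
    (fun ξ => ((‖ξ‖ ^ (2 * s) : ℝ) : ℂ) * weightedFourier φ w f ξ)

/-- The normalization constant of the classical fractional Laplacian on `ℝⁿ`,
`C_{n,s} = s 4^s Γ(n/2 + s) / (π^{n/2} Γ(1 - s))`. -/
def fracLaplacianConst (n : ℕ) (s : ℝ) : ℝ :=
  s * 4 ^ s * Real.Gamma ((n : ℝ) / 2 + s) /
    (Real.pi ^ ((n : ℝ) / 2) * Real.Gamma (1 - s))

/-- `HasPrincipalValue d F L`: the function `F` is integrable on each region `{d > ε}`, `ε > 0`,
and its integrals over these regions converge to `L` as `ε → 0⁺`.  With `d y = ‖x - y‖` this says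
that the usual principal value at `x` of the integral of `F` exists and equals `L`. -/
def HasPrincipalValue (d : EuclideanSpace ℝ (Fin n) → ℝ)
    (F : EuclideanSpace ℝ (Fin n) → ℂ) (L : ℂ) : Prop :=
  (∀ ε : ℝ, 0 < ε → IntegrableOn F {y | ε < d y}) ∧
    Tendsto (fun ε : ℝ => ∫ y in {y | ε < d y}, F y) (𝓝[>] 0) (𝓝 L)

/-- The hypersingular integrand
`(w(x) f(x) - w(y) f(y)) / |φ(x) - φ(y)|^{n+2s} · |J_φ(y)|`. -/
def hypersingularIntegrand (s : ℝ)
    (φ : EuclideanSpace ℝ (Fin n) → EuclideanSpace ℝ (Fin n))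
    (w f : EuclideanSpace ℝ (Fin n) → ℂ) (x y : EuclideanSpace ℝ (Fin n)) : ℂ :=
  (w x * f x - w y * f y) / ((‖φ x - φ y‖ ^ ((n : ℝ) + 2 * s) : ℝ) : ℂ) *
    ((absJacobian φ y : ℝ) : ℂ)

end WeightedFractional

end

namespace WeightedFractional

/-! Put `g = (w f) ∘ φ⁻¹`, a Schwartz function. The substitution `u = φ y` turns the weighted
transform into the classical one and the hypersingular integral into that of `g` at `φ x`, so the
formula reduces to the classical one. There the constant comes from `∫ (1 - cos ξ·v) / |v|^(n+2s) dv
= |ξ|^(2s) / C_{n,s}` (`lintegral_one_sub_cos_div_norm_rpow`): averaging over `v` and `-v`, Fourier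
inversion and Fubini yield `integral_norm_rpow_mul_fourier`. The substitution turns the balls `|x -
y| ≤ ε` into distorted neighbourhoods of `0`, so the limit must not depend on their shape.
Subtracting the odd kernel `cutoffKernel` leaves an absolutely integrable function. The odd kernel
itself integrates to zero outside any ellipsoid centred at `0`, and the distorted neighbourhood
differs from such an ellipsoid by a shell of relative thickness `O(ε)`, which contributes
`O(ε^(2-2s))`. This is `tendsto_setIntegral_of_sub_cutoffKernel`. -/

/-! ### Gamma integrals and the constant `C_{n,s}`. -/

theorem lintegral_rpow_mul_exp_neg_mul {a r : ℝ} (ha : 0 < a) (hr : 0 < r) :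
    ∫⁻ t in Set.Ioi (0 : ℝ), ENNReal.ofReal (t ^ (a - 1) * Real.exp (-(r * t))) =
      ENNReal.ofReal ((1 / r) ^ a * Real.Gamma a) := by
  have h := Real.integral_rpow_mul_exp_neg_mul_Ioi ha hr
  have hpos : 0 < (1 / r) ^ a * Real.Gamma a :=
    mul_pos (Real.rpow_pos_of_pos (by positivity) _) (Real.Gamma_pos_of_pos ha)
  rw [← h, ofReal_integral_eq_lintegral_ofReal]
  · exact Integrable.of_integral_ne_zero (by rw [h]; exact hpos.ne')
  · filter_upwards [ae_restrict_mem measurableSet_Ioi] with t ht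
    have : (0 : ℝ) < t := ht
    simp only [Pi.zero_apply]
    positivity

/-- The substitution `t ↦ 1/t` reduces this to the Gamma integral with exponent `1 - s`. -/
theorem lintegral_rpow_mul_exp_neg_div {s b : ℝ} (hs : s < 1) (hb : 0 < b) :
    ∫⁻ t in Set.Ioi (0 : ℝ), ENNReal.ofReal (t ^ (s - 2) * Real.exp (-(b / t))) =
      ENNReal.ofReal (b ^ (s - 1) * Real.Gamma (1 - s)) := by
  have h := Real.integral_rpow_mul_exp_neg_mul_Ioi (a := 1 - s) (by linarith) hb
  rw [← integral_comp_rpow_Ioi _ (show (-1 : ℝ) ≠ 0 by norm_num)] at h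
  have h2 : ∫ t in Set.Ioi (0 : ℝ), t ^ (s - 2) * Real.exp (-(b / t)) =
      b ^ (s - 1) * Real.Gamma (1 - s) := by
    rw [show b ^ (s - 1) = (1 / b) ^ (1 - s) by
      rw [one_div, Real.inv_rpow hb.le, ← Real.rpow_neg hb.le, neg_sub], ← h]
    refine setIntegral_congr_fun measurableSet_Ioi fun t ht => ?_
    have ht : (0 : ℝ) < t := ht
    simp only [smul_eq_mul, abs_neg, abs_one, one_mul]
    rw [← Real.rpow_mul ht.le, ← mul_assoc, ← Real.rpow_add ht, Real.rpow_neg_one, div_eq_mul_inv]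
    congr 2
    ring
  have hpos : 0 < b ^ (s - 1) * Real.Gamma (1 - s) :=
    mul_pos (Real.rpow_pos_of_pos hb _) (Real.Gamma_pos_of_pos (by linarith))
  rw [← h2, ofReal_integral_eq_lintegral_ofReal]
  · exact Integrable.of_integral_ne_zero (by rw [h2]; exact hpos.ne')
  · filter_upwards [ae_restrict_mem measurableSet_Ioi] with t ht
    have : (0 : ℝ) < t := ht
    simp only [Pi.zero_apply]
    positivity

/-- The integrand is itself `∫₀ᵃ t^(s-2) e^(-b/t) db`; Tonelli then leaves `Γ(1-s) ∫₀ᵃ b^(s-1) db`.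
-/
theorem lintegral_rpow_mul_one_sub_exp {s a : ℝ} (hs : s ∈ Set.Ioo (0 : ℝ) 1) (ha : 0 ≤ a) :
    ∫⁻ t in Set.Ioi (0 : ℝ), ENNReal.ofReal (t ^ (s - 1) * (1 - Real.exp (-(a / t)))) =
      ENNReal.ofReal (a ^ s * (Real.Gamma (1 - s) / s)) := by
  have key : ∀ t ∈ Set.Ioi (0 : ℝ),
      ENNReal.ofReal (t ^ (s - 1) * (1 - Real.exp (-(a / t)))) =
      ∫⁻ b in Set.Ioc 0 a, ENNReal.ofReal (t ^ (s - 2) * Real.exp (-(b / t))) := by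
    intro t ht
    have ht : (0 : ℝ) < t := ht
    have hd : ∀ b ∈ Set.uIcc 0 a, HasDerivAt (fun b => -(t ^ (s - 1) * Real.exp (-(b / t))))
        (t ^ (s - 2) * Real.exp (-(b / t))) b := by
      intro b _
      have h1 : HasDerivAt (fun b : ℝ => -(b / t)) (-(1 / t)) b :=
        ((hasDerivAt_id b).div_const t).neg
      have h2 : HasDerivAt (fun b => -(t ^ (s - 1) * Real.exp (-(b / t))))
          (-(t ^ (s - 1) * (Real.exp (-(b / t)) * -(1 / t)))) b := (h1.exp.const_mul _).neg
      refine h2.congr_deriv ?_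
      rw [show s - 2 = s - 1 - 1 by ring, Real.rpow_sub_one ht.ne' (s - 1)]
      field_simp
    have hc : Continuous fun b : ℝ => t ^ (s - 2) * Real.exp (-(b / t)) := by fun_prop
    have hI := intervalIntegral.integral_eq_sub_of_hasDerivAt hd (hc.intervalIntegrable 0 a)
    rw [← ofReal_integral_eq_lintegral_ofReal, ← intervalIntegral.integral_of_le ha, hI]
    · congr 1
      simp
      ring
    · exact hc.integrableOn_Ioc
    · exact Eventually.of_forall fun b => by simp only [Pi.zero_apply]; positivity
  rw [setLIntegral_congr_fun measurableSet_Ioi key, lintegral_lintegral_swap]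
  · rw [setLIntegral_congr_fun measurableSet_Ioc
      (fun b hb => lintegral_rpow_mul_exp_neg_div hs.2 hb.1)]
    have hI : ∫ b in (0 : ℝ)..a, b ^ (s - 1) * Real.Gamma (1 - s) =
        a ^ s * (Real.Gamma (1 - s) / s) := by
      rw [intervalIntegral.integral_mul_const, integral_rpow (Or.inl (by linarith [hs.1]))]
      have := hs.1.ne'
      simp [Real.zero_rpow this]
      ring
    rw [← hI, intervalIntegral.integral_of_le ha, ofReal_integral_eq_lintegral_ofReal]
    · exact ((intervalIntegral.intervalIntegrable_rpow' (by linarith [hs.1])).mul_const _).1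
    · filter_upwards [ae_restrict_mem measurableSet_Ioc] with b hb
      have := (Real.Gamma_pos_of_pos (show 0 < 1 - s by linarith [hs.2])).le
      have := hb.1.le
      simp only [Pi.zero_apply]
      positivity
  · refine Measurable.aemeasurable ?_
    fun_prop

variable {n : ℕ}

local notation "𝔼" => EuclideanSpace ℝ (Fin n)

/-- Real part of the difference of two Gaussian integrals, with linear terms `0` and `i ξ·v`. -/
theorem integral_one_sub_cos_mul_exp {t : ℝ} (ht : 0 < t) (ξ : EuclideanSpace ℝ (Fin n)) :
    Integrable (fun v : EuclideanSpace ℝ (Fin n) =>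
      (1 - Real.cos (inner ℝ ξ v)) * Real.exp (-(t * ‖v‖ ^ 2))) ∧
    ∫ v : EuclideanSpace ℝ (Fin n), (1 - Real.cos (inner ℝ ξ v)) * Real.exp (-(t * ‖v‖ ^ 2)) =
      (Real.pi / t) ^ ((n : ℝ) / 2) * (1 - Real.exp (-(‖ξ‖ ^ 2 / 4 / t))) := by
  have htc : 0 < (t : ℂ).re := by simpa using ht
  have h0 := GaussianFourier.integral_cexp_neg_mul_sq_norm_add (V := EuclideanSpace ℝ (Fin n))
    htc 0 ξ
  have h1 := GaussianFourier.integral_cexp_neg_mul_sq_norm_add (V := EuclideanSpace ℝ (Fin n))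
    htc Complex.I ξ
  have i0 := GaussianFourier.integrable_cexp_neg_mul_sq_norm_add (V := EuclideanSpace ℝ (Fin n))
    htc 0 ξ
  have i1 := GaussianFourier.integrable_cexp_neg_mul_sq_norm_add (V := EuclideanSpace ℝ (Fin n))
    htc Complex.I ξ
  have hfun : (fun v : EuclideanSpace ℝ (Fin n) =>
      (1 - Real.cos (inner ℝ ξ v)) * Real.exp (-(t * ‖v‖ ^ 2))) = fun v =>
      RCLike.re (Complex.exp (-(t : ℂ) * ‖v‖ ^ 2 + 0 * (inner ℝ ξ v : ℝ)) -
        Complex.exp (-(t : ℂ) * ‖v‖ ^ 2 + Complex.I * (inner ℝ ξ v : ℝ))) := by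
    funext v
    have e : (-(t : ℂ) * ‖v‖ ^ 2) = ((-(t * ‖v‖ ^ 2) : ℝ) : ℂ) := by push_cast; ring
    rw [e, Complex.exp_add, Complex.exp_add, mul_comm Complex.I, ← Complex.ofReal_exp]
    rw [RCLike.re_eq_complex_re, Complex.sub_re, Complex.re_ofReal_mul, Complex.re_ofReal_mul,
      Complex.exp_ofReal_mul_I_re]
    simp only [zero_mul, Complex.exp_zero, Complex.one_re]
    ring
  rw [hfun]
  refine ⟨(i0.sub i1).re, ?_⟩
  have := integral_re (𝕜 := ℂ) (i0.sub i1)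
  simp only [Pi.sub_apply] at this
  rw [this, integral_sub i0 i1, h0, h1]
  have e : ((Real.pi : ℂ) / t) ^ ((Module.finrank ℝ (EuclideanSpace ℝ (Fin n)) : ℂ) / 2) =
      (((Real.pi / t) ^ ((n : ℝ) / 2) : ℝ) : ℂ) := by
    rw [Complex.ofReal_cpow (by positivity)]
    simp
  have e2 : Complex.I ^ 2 * (‖ξ‖ : ℂ) ^ 2 / (4 * t) = ((-(‖ξ‖ ^ 2 / 4 / t) : ℝ) : ℂ) := by
    push_cast
    rw [Complex.I_sq]
    field_simp
  rw [e, e2, ← Complex.ofReal_exp]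
  simp [-Complex.ofReal_exp]
  ring

theorem fracLaplacianConst_pos {s : ℝ} (hs : s ∈ Set.Ioo (0 : ℝ) 1) :
    0 < fracLaplacianConst n s := by
  have h1 : 0 < Real.Gamma ((n : ℝ) / 2 + s) :=
    Real.Gamma_pos_of_pos (by have := hs.1; positivity)
  have h2 : 0 < Real.Gamma (1 - s) := Real.Gamma_pos_of_pos (by linarith [hs.2])
  have := hs.1
  unfold fracLaplacianConst
  positivity

/-- Subordination: `|v|^(-(n+2s))` is a superposition over `t` of the Gaussians `e^(-t|v|²)` with
density `t^(n/2+s-1) / Γ(n/2+s)`. Working in `ENNReal`, Tonelli needs no prior integrability, and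
finiteness is part of the outcome. -/
theorem lintegral_one_sub_cos_div_norm_rpow {s : ℝ} (hs : s ∈ Set.Ioo (0 : ℝ) 1)
    (ξ : EuclideanSpace ℝ (Fin n)) :
    ∫⁻ v : EuclideanSpace ℝ (Fin n),
      ENNReal.ofReal ((1 - Real.cos (inner ℝ ξ v)) / ‖v‖ ^ ((n : ℝ) + 2 * s)) =
      ENNReal.ofReal (‖ξ‖ ^ (2 * s) / fracLaplacianConst n s) := by
  have hs0 := hs.1
  have hα : 0 < (n : ℝ) / 2 + s := by positivity
  have hΓ := Real.Gamma_pos_of_pos hα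
  have hcos : ∀ v : EuclideanSpace ℝ (Fin n), 0 ≤ 1 - Real.cos (inner ℝ ξ v) :=
    fun v => by linarith [Real.cos_le_one (inner ℝ ξ v)]
  have key : ∀ v : EuclideanSpace ℝ (Fin n),
      ENNReal.ofReal ((1 - Real.cos (inner ℝ ξ v)) / ‖v‖ ^ ((n : ℝ) + 2 * s)) =
      ∫⁻ t in Set.Ioi (0 : ℝ), ENNReal.ofReal ((1 - Real.cos (inner ℝ ξ v)) /
        Real.Gamma ((n : ℝ) / 2 + s) *
        (t ^ ((n : ℝ) / 2 + s - 1) * Real.exp (-(t * ‖v‖ ^ 2)))) := by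
    intro v
    rcases eq_or_ne v 0 with rfl | hv
    · simp
    have hv := norm_pos_iff.2 hv
    have h := lintegral_rpow_mul_exp_neg_mul hα (r := ‖v‖ ^ 2) (by positivity)
    simp_rw [mul_comm _ (‖v‖ ^ 2)]
    rw [lintegral_congr (fun t => ENNReal.ofReal_mul (div_nonneg (hcos v) hΓ.le)),
      lintegral_const_mul _ (by fun_prop), h, ← ENNReal.ofReal_mul (div_nonneg (hcos v) hΓ.le)]
    congr 1
    rw [one_div, Real.inv_rpow (by positivity), ← Real.rpow_natCast ‖v‖ 2,
      ← Real.rpow_mul (by positivity)]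
    rw [show ((2 : ℕ) : ℝ) * ((n : ℝ) / 2 + s) = (n : ℝ) + 2 * s by push_cast; ring]
    field_simp
  rw [lintegral_congr key, lintegral_lintegral_swap (by
    refine Measurable.aemeasurable ?_
    fun_prop)]
  have key2 : ∀ t ∈ Set.Ioi (0 : ℝ),
      ∫⁻ v : EuclideanSpace ℝ (Fin n), ENNReal.ofReal ((1 - Real.cos (inner ℝ ξ v)) /
        Real.Gamma ((n : ℝ) / 2 + s) *
        (t ^ ((n : ℝ) / 2 + s - 1) * Real.exp (-(t * ‖v‖ ^ 2)))) =
      ENNReal.ofReal (Real.pi ^ ((n : ℝ) / 2) / Real.Gamma ((n : ℝ) / 2 + s)) *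
      ENNReal.ofReal (t ^ (s - 1) * (1 - Real.exp (-(‖ξ‖ ^ 2 / 4 / t)))) := by
    intro t ht
    have ht : (0 : ℝ) < t := ht
    obtain ⟨hi, he⟩ := integral_one_sub_cos_mul_exp ht ξ
    have hc : 0 ≤ t ^ ((n : ℝ) / 2 + s - 1) / Real.Gamma ((n : ℝ) / 2 + s) := by positivity
    rw [← ENNReal.ofReal_mul (by positivity)]
    have : ∀ v : EuclideanSpace ℝ (Fin n), (1 - Real.cos (inner ℝ ξ v)) /
        Real.Gamma ((n : ℝ) / 2 + s) *
        (t ^ ((n : ℝ) / 2 + s - 1) * Real.exp (-(t * ‖v‖ ^ 2))) =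
        t ^ ((n : ℝ) / 2 + s - 1) / Real.Gamma ((n : ℝ) / 2 + s) *
        ((1 - Real.cos (inner ℝ ξ v)) * Real.exp (-(t * ‖v‖ ^ 2))) := fun v => by ring
    simp_rw [this]
    rw [← ofReal_integral_eq_lintegral_ofReal (hi.const_mul _), integral_const_mul, he]
    · congr 1
      rw [Real.div_rpow Real.pi_pos.le ht.le, show (n : ℝ) / 2 + s - 1 = n / 2 + (s - 1) by ring,
        Real.rpow_add ht]
      field_simp
    · exact Eventually.of_forall fun v =>
        mul_nonneg hc (mul_nonneg (hcos v) (Real.exp_pos _).le)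
  rw [setLIntegral_congr_fun measurableSet_Ioi key2, lintegral_const_mul _ (by fun_prop),
    lintegral_rpow_mul_one_sub_exp hs (by positivity), ← ENNReal.ofReal_mul (by positivity)]
  congr 1
  have hΓ' : 0 < Real.Gamma (1 - s) := Real.Gamma_pos_of_pos (by linarith [hs.2])
  rw [Real.div_rpow (by positivity) (by norm_num), ← Real.rpow_natCast ‖ξ‖ 2,
    ← Real.rpow_mul (norm_nonneg _)]
  unfold fracLaplacianConst
  push_cast
  field_simp

/-! ### Taylor remainders and integrability of the even kernels. -/

/-- The mean value inequality is used twice, with `C` a bound for the second derivative on the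
compact unit ball about `z`. -/
theorem exists_norm_sub_fderiv_le_sq {E F : Type*} [NormedAddCommGroup E] [NormedSpace ℝ E]
    [FiniteDimensional ℝ E] [NormedAddCommGroup F] [NormedSpace ℝ F] {f : E → F}
    (hf : ContDiff ℝ 2 f) (z : E) :
    ∃ C : ℝ, 0 ≤ C ∧ ∀ v : E, ‖v‖ ≤ 1 → ‖f (z + v) - f z - fderiv ℝ f z v‖ ≤ C * ‖v‖ ^ 2 := by
  have hd : ContDiff ℝ 1 (fderiv ℝ f) := hf.fderiv_right (by norm_num)
  have hc : Continuous (fderiv ℝ (fderiv ℝ f)) := hd.continuous_fderiv (by norm_num)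
  obtain ⟨C, hC⟩ := (isCompact_closedBall z 1).exists_bound_of_continuousOn
    (f := fderiv ℝ (fderiv ℝ f)) hc.continuousOn
  have hC0 : 0 ≤ C := (norm_nonneg _).trans (hC z (Metric.mem_closedBall_self zero_le_one))
  refine ⟨C, hC0, fun v hv => ?_⟩
  have h1 : ∀ y ∈ Metric.closedBall z ‖v‖, ‖fderiv ℝ f y - fderiv ℝ f z‖ ≤ C * ‖v‖ := by
    intro y hy
    refine ((convex_closedBall z 1).norm_image_sub_le_of_norm_fderiv_le
      (fun x _ => hd.differentiable (by norm_num) x) hC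
      (Metric.mem_closedBall_self zero_le_one)
      (Metric.closedBall_subset_closedBall hv hy)).trans ?_
    gcongr
    simpa [dist_eq_norm] using hy
  have h2 := (convex_closedBall z ‖v‖).norm_image_sub_le_of_norm_fderiv_le'
    (fun x _ => hf.differentiable (by norm_num) x) h1
    (Metric.mem_closedBall_self (norm_nonneg v)) (y := z + v) (by simp [dist_eq_norm])
  simp only [add_sub_cancel_left] at h2
  linarith [h2, (by ring : C * ‖v‖ * ‖v‖ = C * ‖v‖ ^ 2)]

theorem integrable_one_sub_cos_div_norm_rpow {s : ℝ} (hs : s ∈ Set.Ioo (0 : ℝ) 1) (ξ : 𝔼) :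
    Integrable fun v : 𝔼 => (1 - Real.cos (inner ℝ ξ v)) / ‖v‖ ^ ((n : ℝ) + 2 * s) := by
  have hnn : ∀ v : 𝔼, 0 ≤ (1 - Real.cos (inner ℝ ξ v)) / ‖v‖ ^ ((n : ℝ) + 2 * s) := fun v =>
    div_nonneg (by linarith [Real.cos_le_one (inner ℝ ξ v)]) (by positivity)
  refine ⟨(by fun_prop : Measurable _).aestronglyMeasurable, ?_⟩
  rw [hasFiniteIntegral_iff_ofReal (Eventually.of_forall hnn),
    lintegral_one_sub_cos_div_norm_rpow hs]
  exact ENNReal.ofReal_lt_top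

theorem integral_one_sub_cos_div_norm_rpow {s : ℝ} (hs : s ∈ Set.Ioo (0 : ℝ) 1) (ξ : 𝔼) :
    ∫ v : 𝔼, (1 - Real.cos (inner ℝ ξ v)) / ‖v‖ ^ ((n : ℝ) + 2 * s) =
      ‖ξ‖ ^ (2 * s) / fracLaplacianConst n s := by
  have hnn : ∀ v : 𝔼, 0 ≤ (1 - Real.cos (inner ℝ ξ v)) / ‖v‖ ^ ((n : ℝ) + 2 * s) := fun v =>
    div_nonneg (by linarith [Real.cos_le_one (inner ℝ ξ v)]) (by positivity)
  rw [integral_eq_lintegral_of_nonneg_ae (Eventually.of_forall hnn)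
    (by fun_prop : Measurable _).aestronglyMeasurable, lintegral_one_sub_cos_div_norm_rpow hs,
    ENNReal.toReal_ofReal]
  exact div_nonneg (by positivity) (fracLaplacianConst_pos hs).le

/-- Polar coordinates are avoided: in the unit ball `|v|² ≤ (π²/2) ∑ (1 - cos vᵢ)`, and each summand
divided by `|v|^(n+2s)` is already known to be integrable. Outside, `(1+|v|)^(-(n+2s))` dominates.
-/
theorem integrable_min_one_norm_sq_div {s : ℝ} (hs : s ∈ Set.Ioo (0 : ℝ) 1) :
    Integrable fun v : 𝔼 => min 1 (‖v‖ ^ 2) / ‖v‖ ^ ((n : ℝ) + 2 * s) := by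
  have hs0 := hs.1
  have h1 : Integrable fun v : 𝔼 => ∑ i : Fin n, Real.pi ^ 2 / 2 *
      ((1 - Real.cos (inner ℝ (EuclideanSpace.single i (1 : ℝ)) v)) /
        ‖v‖ ^ ((n : ℝ) + 2 * s)) :=
    integrable_finsetSum _ fun i _ => (integrable_one_sub_cos_div_norm_rpow hs _).const_mul _
  have h2 : Integrable fun v : 𝔼 =>
      (2 : ℝ) ^ ((n : ℝ) + 2 * s) * (1 + ‖v‖) ^ (-((n : ℝ) + 2 * s)) :=
    (integrable_one_add_norm (by simp; linarith)).const_mul _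
  refine (h1.add h2).mono' (by fun_prop : Measurable _).aestronglyMeasurable
    (Eventually.of_forall fun v => ?_)
  have hp : 0 ≤ ‖v‖ ^ ((n : ℝ) + 2 * s) := by positivity
  have hnn : ∀ i : Fin n, 0 ≤ Real.pi ^ 2 / 2 *
      ((1 - Real.cos (inner ℝ (EuclideanSpace.single i (1 : ℝ)) v)) /
        ‖v‖ ^ ((n : ℝ) + 2 * s)) := fun i =>
    mul_nonneg (by positivity) (div_nonneg (sub_nonneg.2 (Real.cos_le_one _)) hp)
  have hmin : 0 ≤ min 1 (‖v‖ ^ 2) := le_min zero_le_one (by positivity)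
  rw [Real.norm_of_nonneg (div_nonneg hmin hp)]
  simp only [Pi.add_apply]
  rcases le_or_gt ‖v‖ 1 with hv | hv
  · refine le_trans ?_ (le_add_of_nonneg_right (by positivity))
    rw [← Finset.mul_sum, ← Finset.sum_div, ← mul_div_assoc]
    refine div_le_div_of_nonneg_right ((min_le_right _ _).trans ?_) hp
    rw [EuclideanSpace.norm_sq_eq, Finset.mul_sum]
    refine Finset.sum_le_sum fun i _ => ?_
    have hvi : |v i| ≤ Real.pi := by
      have := PiLp.norm_apply_le v i
      rw [Real.norm_eq_abs] at this
      linarith [Real.pi_gt_three]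
    have := Real.cos_le_one_sub_mul_cos_sq hvi
    have hpi := Real.pi_pos
    have hin : inner ℝ (EuclideanSpace.single i (1 : ℝ)) v = v i := by
      simp [EuclideanSpace.inner_single_left]
    rw [hin, Real.norm_eq_abs, sq_abs]
    calc v i ^ 2 = Real.pi ^ 2 / 2 * (2 / Real.pi ^ 2 * v i ^ 2) := by field_simp
      _ ≤ _ := by gcongr; linarith
  · refine le_trans ?_ (le_add_of_nonneg_left (Finset.sum_nonneg fun i _ => hnn i))
    have hv0 : 0 < ‖v‖ := by linarith
    calc min 1 (‖v‖ ^ 2) / ‖v‖ ^ ((n : ℝ) + 2 * s) ≤ 1 / ‖v‖ ^ ((n : ℝ) + 2 * s) := by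
          gcongr; exact min_le_left _ _
      _ = (2 : ℝ) ^ ((n : ℝ) + 2 * s) * (2 * ‖v‖) ^ (-((n : ℝ) + 2 * s)) := by
          rw [Real.mul_rpow (by norm_num) hv0.le, Real.rpow_neg (by norm_num),
            Real.rpow_neg hv0.le]
          field_simp
      _ ≤ _ := by
          gcongr ?_ * ?_
          exact Real.rpow_le_rpow_of_nonpos (by positivity) (by linarith)
            (by have : (0 : ℝ) ≤ n := by positivity
                linarith)

/-! ### The odd singular part. -/

/-- The singular part of a hypersingular kernel: the linear form `ℓ` divided by
`‖v‖ ^ (n + 2 s)`, cut off at the unit ball. -/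
noncomputable def cutoffKernel (s : ℝ) (ℓ : 𝔼 →L[ℝ] ℂ) (v : 𝔼) : ℂ :=
  if ‖v‖ ≤ 1 then ℓ v / ((‖v‖ ^ ((n : ℝ) + 2 * s) : ℝ) : ℂ) else 0

theorem measurable_cutoffKernel (s : ℝ) (ℓ : 𝔼 →L[ℝ] ℂ) : Measurable (cutoffKernel s ℓ) := by
  unfold cutoffKernel
  refine Measurable.ite (measurableSet_le measurable_norm measurable_const) ?_ measurable_const
  exact ℓ.measurable.div (by fun_prop)

theorem cutoffKernel_neg (s : ℝ) (ℓ : 𝔼 →L[ℝ] ℂ) (v : 𝔼) :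
    cutoffKernel s ℓ (-v) = -cutoffKernel s ℓ v := by
  unfold cutoffKernel
  split_ifs <;> simp_all [neg_div]

theorem norm_cutoffKernel_le (s : ℝ) (ℓ : 𝔼 →L[ℝ] ℂ) (v : 𝔼) :
    ‖cutoffKernel s ℓ v‖ ≤ ‖ℓ‖ * ‖v‖ / ‖v‖ ^ ((n : ℝ) + 2 * s) := by
  unfold cutoffKernel
  split_ifs
  · rw [norm_div, Complex.norm_real, Real.norm_of_nonneg (by positivity)]
    gcongr
    exact ℓ.le_opNorm v
  · simp only [norm_zero]; positivity

theorem cutoffKernel_eq_zero {s : ℝ} {ℓ : 𝔼 →L[ℝ] ℂ} {v : 𝔼} (hv : 1 < ‖v‖) :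
    cutoffKernel s ℓ v = 0 := if_neg (not_le.2 hv)

theorem integrableOn_cutoffKernel {s : ℝ} (hs : s ∈ Set.Ioo (0 : ℝ) 1) (ℓ : 𝔼 →L[ℝ] ℂ)
    {S : Set 𝔼} (hS : MeasurableSet S) {r : ℝ} (hr : 0 < r) (hSr : ∀ v ∈ S, r ≤ ‖v‖) :
    IntegrableOn (cutoffKernel s ℓ) S := by
  have h := ((integrable_min_one_norm_sq_div (n := n) hs).const_mul (‖ℓ‖ / r)).integrableOn (s := S)
  refine Integrable.mono' h (measurable_cutoffKernel s ℓ).aestronglyMeasurable ?_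
  filter_upwards [ae_restrict_mem hS] with v hv
  have hrv := hSr v hv
  rcases le_or_gt ‖v‖ 1 with h1 | h1
  · refine (norm_cutoffKernel_le s ℓ v).trans ?_
    rw [min_eq_right (by nlinarith [norm_nonneg v]), ← mul_div_assoc]
    gcongr ?_ / _
    rw [div_mul_eq_mul_div, le_div_iff₀ hr, mul_assoc, sq]
    gcongr
  · rw [cutoffKernel_eq_zero h1, norm_zero]
    have : 0 ≤ min 1 (‖v‖ ^ 2) := le_min zero_le_one (by positivity)
    positivity

/-- By oddness and `v ↦ -v` the integral equals its own negative. -/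
theorem setIntegral_cutoffKernel_eq_zero (s : ℝ) (ℓ : 𝔼 →L[ℝ] ℂ) {S : Set 𝔼}
    (hS : MeasurableSet S) (hneg : ∀ v, -v ∈ S ↔ v ∈ S) : ∫ v in S, cutoffKernel s ℓ v = 0 := by
  rw [← integral_indicator hS]
  have h := integral_neg_eq_self (S.indicator (cutoffKernel s ℓ)) volume
  have h2 : ∀ v, S.indicator (cutoffKernel s ℓ) (-v) = -S.indicator (cutoffKernel s ℓ) v := by
    intro v
    by_cases hv : v ∈ S
    · rw [Set.indicator_of_mem hv, Set.indicator_of_mem ((hneg v).2 hv), cutoffKernel_neg]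
    · rw [Set.indicator_of_notMem hv, Set.indicator_of_notMem (fun h => hv ((hneg v).1 h)),
        neg_zero]
  simp_rw [h2, integral_neg] at h
  exact self_eq_neg.1 h.symm

/-! ### Independence of the principal value from the shape of the excised set. -/

/-- The shell is the preimage of an annulus, of volume proportional to `ε^n ((1+ρ)^n - (1-ρ)^n)`;
what matters is that the difference of powers is linear in `ρ`. -/
theorem measureReal_shell_le (A : 𝔼 ≃L[ℝ] 𝔼) :
    ∃ M : ℝ, 0 ≤ M ∧ ∀ ε ρ : ℝ, 0 < ε → 0 ≤ ρ → ρ ≤ 1 / 2 →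
      volume.real {v : 𝔼 | ε - ρ * ε ≤ ‖A v‖ ∧ ‖A v‖ ≤ ε + ρ * ε} ≤ M * ρ * ε ^ n ∧
      volume {v : 𝔼 | ε - ρ * ε ≤ ‖A v‖ ∧ ‖A v‖ ≤ ε + ρ * ε} < ⊤ := by
  set d : ℝ := |LinearMap.det (A.symm : 𝔼 →ₗ[ℝ] 𝔼)| with hd
  set b : ℝ := volume.real (Metric.closedBall (0 : 𝔼) 1) with hb
  refine ⟨d * b * (2 * n * 2 ^ (n - 1)), by positivity, fun ε ρ hε hρ hρ' => ?_⟩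
  have hset : {v : 𝔼 | ε - ρ * ε ≤ ‖A v‖ ∧ ‖A v‖ ≤ ε + ρ * ε} =
      A ⁻¹' (Metric.closedBall 0 ((1 + ρ) * ε) \ Metric.ball 0 ((1 - ρ) * ε)) := by
    ext v
    simp only [Set.mem_ofPred_eq, Set.mem_preimage, Set.mem_sdiff, mem_closedBall_zero_iff,
      mem_ball_zero_iff, not_lt]
    rw [and_comm, add_mul, sub_mul, one_mul]
  have hsub : Metric.ball (0 : 𝔼) ((1 - ρ) * ε) ⊆ Metric.closedBall 0 ((1 + ρ) * ε) :=
    Metric.ball_subset_closedBall.trans (Metric.closedBall_subset_closedBall (by nlinarith))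
  have hvol : volume (Metric.closedBall (0 : 𝔼) ((1 + ρ) * ε) \ Metric.ball 0 ((1 - ρ) * ε))
      < ⊤ := (measure_mono Set.sdiff_subset).trans_lt measure_closedBall_lt_top
  rw [hset, measureReal_def, Measure.addHaar_preimage_continuousLinearEquiv]
  refine ⟨?_, ENNReal.mul_lt_top ENNReal.ofReal_lt_top hvol⟩
  rw [ENNReal.toReal_mul, ENNReal.toReal_ofReal (abs_nonneg _), ← measureReal_def,
    measureReal_sdiff hsub measurableSet_ball measure_closedBall_lt_top.ne, ← hd]
  have hball : volume.real (Metric.ball (0 : 𝔼) ((1 - ρ) * ε)) = ((1 - ρ) * ε) ^ n * b := by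
    rw [measureReal_def, Measure.addHaar_ball_of_pos _ _ (mul_pos (by linarith) hε), hb,
      ← Measure.addHaar_unitClosedBall_eq_addHaar_unitBall, ENNReal.toReal_mul,
      ENNReal.toReal_ofReal (pow_nonneg (mul_nonneg (by linarith) hε.le) _), measureReal_def]
    simp
  rw [hball, Measure.addHaar_real_closedBall' _ _ (by positivity), ← hb]
  simp only [finrank_euclideanSpace, Fintype.card_fin, mul_pow]
  have hpow : (1 + ρ) ^ n - (1 - ρ) ^ n ≤ 2 * ρ * n * 2 ^ (n - 1) := by
    refine (le_abs_self _).trans ((abs_pow_sub_pow_le (1 + ρ) (1 - ρ) n).trans ?_)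
    rw [show 1 + ρ - (1 - ρ) = 2 * ρ by ring, abs_of_nonneg (by linarith : 0 ≤ 2 * ρ)]
    gcongr
    exact max_le (by rw [abs_of_nonneg] <;> linarith) (by rw [abs_of_nonneg] <;> linarith)
  calc d * ((1 + ρ) ^ n * ε ^ n * b - (1 - ρ) ^ n * ε ^ n * b)
      = d * b * ε ^ n * ((1 + ρ) ^ n - (1 - ρ) ^ n) := by ring
    _ ≤ d * b * ε ^ n * (2 * ρ * n * 2 ^ (n - 1)) := by gcongr
    _ = _ := by ring

/-- If `ψ` agrees with the linear isomorphism `A` to second order at the origin, then the regions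
`{ε < ‖ψ v‖}` and `{ε < ‖A v‖}` differ, inside the unit ball, only on a thin shell. -/
theorem exists_mem_shell {ψ : 𝔼 → 𝔼} (A : 𝔼 ≃L[ℝ] 𝔼) {C : ℝ} (hC : 0 ≤ C)
    (hψ : ∀ v, ‖v‖ ≤ 1 → ‖ψ v - A v‖ ≤ C * ‖v‖ ^ 2)
    (hδ : ∀ r > 0, ∃ δ > 0, ∀ v, r ≤ ‖v‖ → δ ≤ ‖ψ v‖) :
    ∃ a b D δ : ℝ, 0 < a ∧ 0 < b ∧ 0 ≤ D ∧ 0 < δ ∧ ∀ ε, 0 < ε → ε < δ → D * ε ≤ 1 / 2 ∧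
      ∀ v, ‖v‖ ≤ 1 → ¬(ε < ‖ψ v‖ ↔ ε < ‖A v‖) →
        ‖v‖ ≤ a * ε ∧ ε / b ≤ ‖v‖ ∧ ε - D * ε * ε ≤ ‖A v‖ ∧ ‖A v‖ ≤ ε + D * ε * ε := by
  set k : ℝ := ‖(A.symm : 𝔼 →L[ℝ] 𝔼)‖ + 1 with hk
  set b : ℝ := ‖(A : 𝔼 →L[ℝ] 𝔼)‖ + 1 with hb
  have hk0 : 0 < k := by positivity
  have hb0 : 0 < b := by positivity
  have hkA : ∀ v, ‖v‖ ≤ k * ‖A v‖ := fun v => by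
    have h := (A.symm : 𝔼 →L[ℝ] 𝔼).le_opNorm (A v)
    simp only [ContinuousLinearEquiv.coe_coe, ContinuousLinearEquiv.symm_apply_apply] at h
    rw [hk, add_mul]
    linarith [norm_nonneg (A v)]
  have hbA : ∀ v, ‖A v‖ ≤ b * ‖v‖ := fun v => by
    have h := (A : 𝔼 →L[ℝ] 𝔼).le_opNorm v
    simp only [ContinuousLinearEquiv.coe_coe] at h
    rw [hb, add_mul]
    linarith [norm_nonneg v]
  set D : ℝ := C * (2 * k) ^ 2 with hD
  have hD0 : 0 ≤ D := by positivity
  -- For `‖v‖` below this radius `k * C * ‖v‖ ≤ 1 / 2`, so the quadratic error is absorbed into `‖v‖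
  -- / 2`.
  obtain ⟨δ, hδ0, hδv⟩ := hδ (1 / (2 * k * (C + 1))) (by positivity)
  refine ⟨2 * k, 2 * b, D, min δ (1 / (2 * (D + 1))), by positivity, by positivity, hD0,
    by positivity, fun ε hε hεδ => ?_⟩
  have hDε : D * ε ≤ 1 / 2 := by
    have h := (hεδ.trans_le (min_le_right _ _)).le
    rw [le_div_iff₀ (by positivity)] at h
    nlinarith
  refine ⟨hDε, fun v hv hne => ?_⟩
  have hdiff := hψ v hv
  have htri1 : ‖ψ v‖ ≤ ‖A v‖ + ‖ψ v - A v‖ := by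
    simpa using norm_add_le (A v) (ψ v - A v)
  have htri2 : ‖A v‖ ≤ ‖ψ v‖ + ‖ψ v - A v‖ := by
    simpa using norm_sub_le (ψ v) (ψ v - A v)
  have hle : ‖v‖ ≤ 2 * k * ε := by
    rcases le_or_gt ‖A v‖ ε with h | h
    · have := hkA v
      nlinarith
    · have hψε : ‖ψ v‖ ≤ ε := by
        by_contra hcon
        exact hne ⟨fun _ => h, fun _ => not_le.1 hcon⟩
      have hvr : ‖v‖ < 1 / (2 * k * (C + 1)) := by
        by_contra hcon
        linarith [hδv v (not_lt.1 hcon), hεδ.trans_le (min_le_left _ _)]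
      rw [lt_div_iff₀ (by positivity)] at hvr
      have h1 : ‖v‖ ≤ k * (ε + C * ‖v‖ ^ 2) := (hkA v).trans (by gcongr; linarith)
      have h2 : k * C * ‖v‖ ^ 2 ≤ ‖v‖ / 2 := by
        have h3 : k * C * ‖v‖ ≤ 1 / 2 := by nlinarith [mul_nonneg hk0.le (norm_nonneg v)]
        nlinarith [norm_nonneg v]
      nlinarith
  have hdiff' : ‖ψ v - A v‖ ≤ D * ε * ε := by
    refine hdiff.trans ?_
    calc C * ‖v‖ ^ 2 ≤ C * (2 * k * ε) ^ 2 := by gcongr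
      _ = D * ε * ε := by rw [hD]; ring
  have hshell : ε - D * ε * ε ≤ ‖A v‖ ∧ ‖A v‖ ≤ ε + D * ε * ε := by
    have h0 : 0 ≤ D * ε * ε := by positivity
    rcases le_or_gt ‖A v‖ ε with h | h
    · have hψε : ε < ‖ψ v‖ := by
        by_contra hcon
        exact hne ⟨fun h' => absurd h' hcon, fun h' => absurd h (not_le.2 h')⟩
      constructor <;> linarith
    · have hψε : ‖ψ v‖ ≤ ε := by
        by_contra hcon
        exact hne ⟨fun _ => h, fun _ => not_le.1 hcon⟩
      constructor <;> linarith
  refine ⟨hle, ?_, hshell⟩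
  rw [div_le_iff₀ (by positivity)]
  have := hbA v
  have := hshell.1
  nlinarith

/-- The integral over `{ε < ‖A v‖}` is zero by symmetry. The discrepancy lives on a shell of volume
`O(ε^(n+1))`, where the kernel is `O(ε^(1-n-2s))`; the product `ε^(2-2s)` tends to `0` because `s <
1`. -/
theorem tendsto_setIntegral_cutoffKernel {s : ℝ} (hs : s ∈ Set.Ioo (0 : ℝ) 1) (ℓ : 𝔼 →L[ℝ] ℂ)
    {ψ : 𝔼 → 𝔼} (hψm : Measurable ψ) (A : 𝔼 ≃L[ℝ] 𝔼) {C : ℝ} (hC : 0 ≤ C)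
    (hψ : ∀ v, ‖v‖ ≤ 1 → ‖ψ v - A v‖ ≤ C * ‖v‖ ^ 2)
    (hδ : ∀ r > 0, ∃ δ > 0, ∀ v, r ≤ ‖v‖ → δ ≤ ‖ψ v‖)
    (hint : ∀ ε, 0 < ε → IntegrableOn (cutoffKernel s ℓ) {v | ε < ‖ψ v‖})
    (hintA : ∀ ε, 0 < ε → IntegrableOn (cutoffKernel s ℓ) {v | ε < ‖A v‖}) :
    Tendsto (fun ε : ℝ => ∫ v in {v | ε < ‖ψ v‖}, cutoffKernel s ℓ v) (𝓝[>] 0) (𝓝 0) := by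
  obtain ⟨a, b, D, δ, ha, hb, hD, hδ0, hshell⟩ := exists_mem_shell A hC hψ hδ
  obtain ⟨M, hM, hvol⟩ := measureReal_shell_le A
  set p : ℝ := (n : ℝ) + 2 * s with hp
  have hp0 : 0 < p := by have := hs.1; positivity
  have hlim : Tendsto (fun ε : ℝ => ‖ℓ‖ * a * b ^ p * M * D * ε ^ (2 - 2 * s)) (𝓝[>] 0) (𝓝 0) := by
    have h : Tendsto (fun ε : ℝ => ε ^ (2 - 2 * s)) (𝓝[>] 0) (𝓝 ((0 : ℝ) ^ (2 - 2 * s))) :=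
      ((Real.continuousAt_rpow_const 0 _ (Or.inr (by linarith [hs.2]))).tendsto).mono_left
        nhdsWithin_le_nhds
    rw [Real.zero_rpow (by linarith [hs.2])] at h
    simpa using h.const_mul (‖ℓ‖ * a * b ^ p * M * D)
  refine squeeze_zero_norm' ?_ hlim
  filter_upwards [Ioo_mem_nhdsGT hδ0] with ε ⟨hε, hεδ⟩
  obtain ⟨hDε, hsh⟩ := hshell ε hε hεδ
  obtain ⟨hv1, hv2⟩ := hvol ε (D * ε) hε (by positivity) hDε
  set Sh : Set 𝔼 := {v : 𝔼 | ε - D * ε * ε ≤ ‖A v‖ ∧ ‖A v‖ ≤ ε + D * ε * ε} with hSh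
  have hmU : MeasurableSet {v : 𝔼 | ε < ‖ψ v‖} := measurableSet_lt measurable_const hψm.norm
  have hmV : MeasurableSet {v : 𝔼 | ε < ‖A v‖} :=
    measurableSet_lt measurable_const A.continuous.measurable.norm
  have hmS : MeasurableSet Sh :=
    (measurableSet_le measurable_const A.continuous.measurable.norm).inter
      (measurableSet_le A.continuous.measurable.norm measurable_const)
  have hzero : ∫ v in {v | ε < ‖A v‖}, cutoffKernel s ℓ v = 0 :=
    setIntegral_cutoffKernel_eq_zero s ℓ hmV fun v => by simp
  rw [← sub_zero (∫ v in {v | ε < ‖ψ v‖}, cutoffKernel s ℓ v), ← hzero,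
    ← integral_indicator hmU, ← integral_indicator hmV,
    ← integral_sub ((hint ε hε).integrable_indicator hmU) ((hintA ε hε).integrable_indicator hmV)]
  set B : ℝ := ‖ℓ‖ * (a * ε) / (ε / b) ^ p with hB
  have hbound : ∀ v, ‖({v | ε < ‖ψ v‖}.indicator (cutoffKernel s ℓ) v -
      {v | ε < ‖A v‖}.indicator (cutoffKernel s ℓ) v)‖ ≤ Sh.indicator (fun _ => B) v := by
    intro v
    have hB0 : 0 ≤ Sh.indicator (fun _ => B) v := Set.indicator_nonneg (fun _ _ => by positivity) v
    by_cases hiff : ε < ‖ψ v‖ ↔ ε < ‖A v‖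
    · have : {v | ε < ‖ψ v‖}.indicator (cutoffKernel s ℓ) v =
          {v | ε < ‖A v‖}.indicator (cutoffKernel s ℓ) v := by
        simp only [Set.indicator, Set.mem_ofPred_eq, hiff]
      rw [this, sub_self, norm_zero]
      exact hB0
    · rcases le_or_gt ‖v‖ 1 with h1 | h1
      · obtain ⟨h2, h3, h4⟩ := hsh v h1 hiff
        have hvS : v ∈ Sh := h4
        rw [Set.indicator_of_mem hvS]
        have hle : ‖cutoffKernel s ℓ v‖ ≤ B := by
          refine (norm_cutoffKernel_le s ℓ v).trans ?_
          rw [hB]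
          gcongr
        by_cases hU : ε < ‖ψ v‖
        · have hV : ¬ε < ‖A v‖ := fun h => hiff ⟨fun _ => h, fun _ => hU⟩
          simpa [Set.indicator, hU, hV] using hle
        · have hV : ε < ‖A v‖ := by
            by_contra h
            exact hiff ⟨fun h' => absurd h' hU, fun h' => absurd h' h⟩
          simpa [Set.indicator, hU, hV] using hle
      -- Outside the unit ball the regions may differ freely, since the kernel vanishes there.
      · simpa [Set.indicator, cutoffKernel_eq_zero h1] using hB0
  refine (norm_integral_le_of_norm_le ?_ (Eventually.of_forall hbound)).trans ?_
  · exact (integrable_indicator_iff hmS).2 (integrableOn_const hv2.ne)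
  rw [integral_indicator hmS, setIntegral_const, smul_eq_mul]
  calc volume.real Sh * B ≤ M * (D * ε) * ε ^ n * B := by gcongr
    _ = ‖ℓ‖ * a * b ^ p * M * D * ε ^ (2 - 2 * s) := by
      rw [hB, Real.div_rpow hε.le hb.le, hp, Real.rpow_add hε, Real.rpow_natCast,
        show (2 - 2 * s) = (2 : ℕ) - 2 * s by norm_num, Real.rpow_sub hε, Real.rpow_natCast]
      field_simp

/-- A kernel that differs from a cutoff kernel by an integrable function has a principal value,
and this value does not depend on the shape `{‖ψ v‖ ≤ ε}` of the excised neighbourhoods. -/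
theorem tendsto_setIntegral_of_sub_cutoffKernel {s : ℝ} (hs : s ∈ Set.Ioo (0 : ℝ) 1)
    (ℓ : 𝔼 →L[ℝ] ℂ) {K : 𝔼 → ℂ} (hK : Integrable (fun v => K v - cutoffKernel s ℓ v))
    (hK0 : K 0 = 0)
    {ψ : 𝔼 → 𝔼} (hψm : Measurable ψ) (A : 𝔼 ≃L[ℝ] 𝔼) {C : ℝ} (hC : 0 ≤ C)
    (hψ : ∀ v, ‖v‖ ≤ 1 → ‖ψ v - A v‖ ≤ C * ‖v‖ ^ 2)
    (hδ : ∀ r > 0, ∃ δ > 0, ∀ v, r ≤ ‖v‖ → δ ≤ ‖ψ v‖) :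
    (∀ ε, 0 < ε → IntegrableOn K {v | ε < ‖ψ v‖}) ∧
    Tendsto (fun ε : ℝ => ∫ v in {v | ε < ‖ψ v‖}, K v) (𝓝[>] 0)
      (𝓝 (∫ v, (K v - cutoffKernel s ℓ v))) := by
  have hm : ∀ ε, MeasurableSet {v : 𝔼 | ε < ‖ψ v‖} := fun ε =>
    measurableSet_lt measurable_const hψm.norm
  -- In the unit ball `‖ψ v‖ ≤ (‖A‖ + C) ‖v‖`, so the region avoids a ball about the origin.
  have hfar : ∀ ε, 0 < ε → ∃ r > 0, ∀ v ∈ {v : 𝔼 | ε < ‖ψ v‖}, r ≤ ‖v‖ := by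
    intro ε hε
    set b : ℝ := ‖(A : 𝔼 →L[ℝ] 𝔼)‖ + C + 1 with hb
    have hb0 : 0 < b := by positivity
    refine ⟨min 1 (ε / b), by positivity, fun v hv => ?_⟩
    rcases le_or_gt ‖v‖ 1 with h1 | h1
    · refine (min_le_right _ _).trans ?_
      rw [div_le_iff₀ hb0]
      have hv : ε < ‖ψ v‖ := hv
      have h2 : ‖ψ v‖ ≤ ‖A v‖ + ‖ψ v - A v‖ := by
        simpa using norm_add_le (A v) (ψ v - A v)
      have h3 := (A : 𝔼 →L[ℝ] 𝔼).le_opNorm v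
      simp only [ContinuousLinearEquiv.coe_coe] at h3
      have h4 := hψ v h1
      have h5 : C * ‖v‖ ^ 2 ≤ C * ‖v‖ := by
        gcongr
        nlinarith [norm_nonneg v]
      rw [hb]
      nlinarith [norm_nonneg v]
    · exact (min_le_left _ _).trans h1.le
  have hint : ∀ ε, 0 < ε → IntegrableOn (cutoffKernel s ℓ) {v | ε < ‖ψ v‖} := fun ε hε => by
    obtain ⟨r, hr, h⟩ := hfar ε hε
    exact integrableOn_cutoffKernel hs ℓ (hm ε) hr h
  have hintA : ∀ ε, 0 < ε → IntegrableOn (cutoffKernel s ℓ) {v | ε < ‖A v‖} := fun ε hε => by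
    refine integrableOn_cutoffKernel hs ℓ
      (measurableSet_lt measurable_const A.continuous.measurable.norm)
      (r := ε / (‖(A : 𝔼 →L[ℝ] 𝔼)‖ + 1)) (by positivity) fun v hv => ?_
    have hv : ε < ‖A v‖ := hv
    have h3 := (A : 𝔼 →L[ℝ] 𝔼).le_opNorm v
    simp only [ContinuousLinearEquiv.coe_coe] at h3
    rw [div_le_iff₀ (by positivity)]
    nlinarith [norm_nonneg v]
  have hsplit : ∀ v, K v = (K v - cutoffKernel s ℓ v) + cutoffKernel s ℓ v := fun v => by ring
  refine ⟨fun ε hε => (hK.integrableOn.add (hint ε hε)).congr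
    (Eventually.of_forall fun v => (hsplit v).symm), ?_⟩
  have h1 := tendsto_setIntegral_cutoffKernel hs ℓ hψm A hC hψ hδ hint hintA
  have h2 : Tendsto (fun ε : ℝ => ∫ v in {v | ε < ‖ψ v‖}, (K v - cutoffKernel s ℓ v)) (𝓝[>] 0)
      (𝓝 (∫ v, (K v - cutoffKernel s ℓ v))) := by
    simp_rw [fun ε => (integral_indicator (hm ε)
      (f := fun v => K v - cutoffKernel s ℓ v) (μ := volume)).symm]
    refine tendsto_integral_filter_of_dominated_convergence
      (fun v => ‖K v - cutoffKernel s ℓ v‖) (Eventually.of_forall fun ε =>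
        hK.aestronglyMeasurable.indicator (hm ε))
      (Eventually.of_forall fun ε => Eventually.of_forall fun v => norm_indicator_le_norm_self _ _)
      hK.norm (Eventually.of_forall fun v => ?_)
    rcases eq_or_ne v 0 with rfl | hv
    · have h0 : K 0 - cutoffKernel s ℓ 0 = 0 := by simp [hK0, cutoffKernel]
      rw [h0]
      refine tendsto_const_nhds.congr fun ε => ?_
      simp [Set.indicator, h0]
    · obtain ⟨δ, hδ0, hδv⟩ := hδ ‖v‖ (norm_pos_iff.2 hv)
      refine tendsto_const_nhds.congr' ?_
      filter_upwards [Ioo_mem_nhdsGT hδ0] with ε hε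
      have hmem : v ∈ {v : 𝔼 | ε < ‖ψ v‖} := hε.2.trans_le (hδv v le_rfl)
      simp only [Set.indicator_of_mem hmem]
  have h3 := h2.add h1
  rw [add_zero] at h3
  refine h3.congr' ?_
  filter_upwards [self_mem_nhdsWithin] with ε hε
  rw [← integral_add hK.integrableOn (hint ε hε)]
  simp

/-! ### The classical representation on the Fourier side. -/

open scoped FourierTransform

/-- In the unit ball the cutoff kernel removes the first-order Taylor term, leaving `O(|v|²)`;
outside it, boundedness of `g` suffices. -/
theorem integrable_sub_cutoffKernel {s : ℝ} (hs : s ∈ Set.Ioo (0 : ℝ) 1) (g : 𝓢(𝔼, ℂ)) (z : 𝔼) :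
    Integrable fun v => (g z - g (z + v)) / ((‖v‖ ^ ((n : ℝ) + 2 * s) : ℝ) : ℂ) -
      cutoffKernel s (-fderiv ℝ g z) v := by
  obtain ⟨C, hC, hT⟩ := exists_norm_sub_fderiv_le_sq (g.smooth 2) z
  obtain ⟨B, hB⟩ : ∃ B, ∀ x, ‖g x‖ ≤ B := by
    obtain ⟨B, hB⟩ := g.decay 0 0
    exact ⟨B, fun x => by simpa using hB.2 x⟩
  have hB0 : 0 ≤ B := (norm_nonneg _).trans (hB 0)
  have hg := g.continuous
  refine ((integrable_min_one_norm_sq_div hs).const_mul (C + 2 * B)).mono' ?_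
    (Eventually.of_forall fun v => ?_)
  · refine Measurable.aestronglyMeasurable (Measurable.sub ?_ (measurable_cutoffKernel s _))
    exact (by fun_prop : Continuous fun v => g z - g (z + v)).measurable.div (by fun_prop)
  · have hp : 0 ≤ ‖v‖ ^ ((n : ℝ) + 2 * s) := by positivity
    rw [← mul_div_assoc]
    rcases le_or_gt ‖v‖ 1 with hv | hv
    · rw [cutoffKernel, if_pos hv, ← sub_div, norm_div, Complex.norm_real, Real.norm_of_nonneg hp]
      refine div_le_div_of_nonneg_right ?_ hp
      rw [min_eq_right (by nlinarith [norm_nonneg v]),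
        show g z - g (z + v) - (-fderiv ℝ g z) v = -(g (z + v) - g z - fderiv ℝ g z v) by
          rw [neg_apply]; ring, norm_neg]
      exact (hT v hv).trans (by gcongr; linarith)
    · rw [cutoffKernel_eq_zero hv, sub_zero, norm_div, Complex.norm_real, Real.norm_of_nonneg hp]
      refine div_le_div_of_nonneg_right ?_ hp
      rw [min_eq_left (by nlinarith)]
      linarith [norm_sub_le (g z) (g (z + v)), hB z, hB (z + v)]

theorem integrable_fourier_mul_norm_rpow {s : ℝ} (hs : s ∈ Set.Ioo (0 : ℝ) 1) (h : 𝓢(𝔼, ℂ)) :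
    Integrable fun η : 𝔼 => ‖h η‖ * ‖(2 * Real.pi) • η‖ ^ (2 * s) := by
  have h0 := (h.integrable (μ := volume)).norm
  have h2 := h.integrable_pow_mul volume 2
  have hs0 := hs.1
  refine (h0.add (h2.const_mul ((2 * Real.pi) ^ 2))).mono' ?_ (Eventually.of_forall fun η => ?_)
  · have := h.continuous
    exact (by fun_prop : Measurable fun η : 𝔼 =>
      ‖h η‖ * ‖(2 * Real.pi) • η‖ ^ (2 * s)).aestronglyMeasurable
  · rw [Real.norm_of_nonneg (by positivity)]
    have hr : ‖(2 * Real.pi) • η‖ ^ (2 * s) ≤ 1 + (2 * Real.pi) ^ 2 * ‖η‖ ^ 2 := by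
      rw [← mul_pow, ← Real.norm_of_nonneg (by positivity : 0 ≤ 2 * Real.pi), ← norm_smul]
      rw [Real.norm_of_nonneg (by positivity : 0 ≤ 2 * Real.pi)]
      rcases le_or_gt ‖(2 * Real.pi) • η‖ 1 with h1 | h1
      · have := Real.rpow_le_one (norm_nonneg _) h1 (by linarith : 0 ≤ 2 * s)
        nlinarith [sq_nonneg ‖(2 * Real.pi) • η‖]
      · have := Real.rpow_le_rpow_of_exponent_le h1.le (by push_cast; linarith [hs.2] : 2 * s ≤ (2 : ℕ))
        rw [Real.rpow_natCast] at this
        linarith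
    simp only [Pi.add_apply]
    calc ‖h η‖ * ‖(2 * Real.pi) • η‖ ^ (2 * s)
        ≤ ‖h η‖ * (1 + (2 * Real.pi) ^ 2 * ‖η‖ ^ 2) := by gcongr
      _ = _ := by ring

theorem eq_integral_fourier (g : 𝓢(𝔼, ℂ)) (z : 𝔼) :
    g z = ∫ η : 𝔼, Complex.exp (Complex.I * ((inner ℝ ((2 * Real.pi) • η) z : ℝ) : ℂ)) *
      (𝓕 g) η := by
  have h : (𝓕⁻ (𝓕 g)) z = g z := by rw [FourierTransform.fourierInv_fourier_eq]
  rw [← h, SchwartzMap.fourierInv_coe, Real.fourierInv_eq']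
  refine integral_congr_ae (Eventually.of_forall fun η => ?_)
  simp only [smul_eq_mul, inner_smul_left]
  congr 2
  simp
  ring

theorem integrable_exp_mul_fourier (g : 𝓢(𝔼, ℂ)) (z : 𝔼) :
    Integrable fun η : 𝔼 =>
      Complex.exp (Complex.I * ((inner ℝ ((2 * Real.pi) • η) z : ℝ) : ℂ)) * (𝓕 g) η := by
  have hc := (𝓕 g).continuous
  refine (𝓕 g).integrable.norm.mono' (by fun_prop : Continuous _).aestronglyMeasurable
    (Eventually.of_forall fun η => ?_)
  rw [norm_mul, mul_comm Complex.I, Complex.norm_exp_ofReal_mul_I, one_mul]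

/-- Fourier inversion together with `2 - e^(iθ) - e^(-iθ) = 2 (1 - cos θ)`: the symmetrized
difference involves only the even kernel. -/
theorem two_mul_sub_sub_eq_integral_fourier (g : 𝓢(𝔼, ℂ)) (z v : 𝔼) :
    (g z - g (z + v)) + (g z - g (z + -v)) =
      ∫ η : 𝔼, 2 * (Complex.exp (Complex.I * ((inner ℝ ((2 * Real.pi) • η) z : ℝ) : ℂ)) * (𝓕 g) η) *
        ((1 - Real.cos (inner ℝ ((2 * Real.pi) • η) v) : ℝ) : ℂ) := by
  have i0 := integrable_exp_mul_fourier g z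
  have i1 := integrable_exp_mul_fourier g (z + v)
  have i2 := integrable_exp_mul_fourier g (z + -v)
  rw [eq_integral_fourier g z, eq_integral_fourier g (z + v), eq_integral_fourier g (z + -v),
    ← integral_sub i0 i1, ← integral_sub i0 i2]
  refine (integral_add (i0.sub i1) (i0.sub i2)).symm.trans ?_
  refine integral_congr_ae (Eventually.of_forall fun η => ?_)
  simp only [Pi.sub_apply, inner_add_right, inner_neg_right, Complex.ofReal_add, Complex.ofReal_neg, mul_add,
    mul_neg, Complex.exp_add, Complex.ofReal_sub, Complex.ofReal_one, Complex.ofReal_cos,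
    Complex.cos]
  rw [mul_comm Complex.I (inner ℝ ((2 * Real.pi) • η) v : ℂ), ← neg_mul]
  ring

/-- The hypersingular representation of the classical fractional Laplacian. -/
theorem integral_norm_rpow_mul_fourier {s : ℝ} (hs : s ∈ Set.Ioo (0 : ℝ) 1) (g : 𝓢(𝔼, ℂ)) (z : 𝔼) :
    ∫ η : 𝔼, Complex.exp (Complex.I * ((inner ℝ ((2 * Real.pi) • η) z : ℝ) : ℂ)) *
      (((‖(2 * Real.pi) • η‖ ^ (2 * s) : ℝ) : ℂ) * (𝓕 g) η) =
    fracLaplacianConst n s * ∫ v, ((g z - g (z + v)) / ((‖v‖ ^ ((n : ℝ) + 2 * s) : ℝ) : ℂ) -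
      cutoffKernel s (-fderiv ℝ g z) v) := by
  set R : 𝔼 → ℂ := fun v => (g z - g (z + v)) / ((‖v‖ ^ ((n : ℝ) + 2 * s) : ℝ) : ℂ) -
      cutoffKernel s (-fderiv ℝ g z) v with hR
  have hRi : Integrable R := integrable_sub_cutoffKernel hs g z
  set F : 𝔼 → ℂ := fun η =>
    2 * (Complex.exp (Complex.I * ((inner ℝ ((2 * Real.pi) • η) z : ℝ) : ℂ)) * (𝓕 g) η) with hF
  set k : 𝔼 → 𝔼 → ℝ := fun η v =>
    (1 - Real.cos (inner ℝ ((2 * Real.pi) • η) v)) / ‖v‖ ^ ((n : ℝ) + 2 * s) with hk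
  have hk0 : ∀ η v, 0 ≤ k η v := fun η v =>
    div_nonneg (sub_nonneg.2 (Real.cos_le_one _)) (by positivity)
  have hc := fracLaplacianConst_pos (n := n) hs
  have hFn : ∀ η, ‖F η‖ = 2 * ‖(𝓕 g) η‖ := fun η => by
    rw [hF]
    simp only
    rw [norm_mul, norm_mul, mul_comm Complex.I, Complex.norm_exp_ofReal_mul_I, one_mul]
    simp
  have hFc : Continuous F := by
    have := (𝓕 g).continuous
    fun_prop
  have hki : ∀ η, Integrable (k η) := fun η => integrable_one_sub_cos_div_norm_rpow hs _
  -- Fubini is justified by the exact inner integral: in `v` it gives a multiple of `|2πη|^(2s)`,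
  -- which is integrable against the Schwartz function `𝓕 g`.
  have hprod : Integrable (Function.uncurry fun η v => F η * (k η v : ℂ))
      ((volume : Measure 𝔼).prod (volume : Measure 𝔼)) := by
    have hm : Measurable (Function.uncurry fun η v => F η * (k η v : ℂ)) := by
      have hFm : Measurable fun q : 𝔼 × 𝔼 => F q.1 := hFc.measurable.comp measurable_fst
      have hkm : Measurable fun q : 𝔼 × 𝔼 => k q.1 q.2 := by
        have h1 : Continuous fun q : 𝔼 × 𝔼 => 1 - Real.cos (inner ℝ ((2 * Real.pi) • q.1) q.2) := by
          fun_prop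
        have h2 : Measurable fun q : 𝔼 × 𝔼 => ‖q.2‖ ^ ((n : ℝ) + 2 * s) :=
          (measurable_norm.comp measurable_snd).pow_const _
        exact h1.measurable.div h2
      exact hFm.mul (Complex.measurable_ofReal.comp hkm)
    rw [integrable_prod_iff hm.aestronglyMeasurable]
    have hFk : ∀ η, Integrable fun v => F η * (k η v : ℂ) := fun η =>
      ((hki η).ofReal (𝕜 := ℂ)).const_mul (F η)
    refine ⟨Eventually.of_forall hFk, ?_⟩
    have hn : ∀ η, ∫ v, ‖Function.uncurry (fun η v => F η * (k η v : ℂ)) (η, v)‖ =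
        2 / fracLaplacianConst n s * (‖(𝓕 g) η‖ * ‖(2 * Real.pi) • η‖ ^ (2 * s)) := fun η => by
      simp only [Function.uncurry_apply_pair, norm_mul, Complex.norm_real, hFn,
        Real.norm_of_nonneg (hk0 _ _)]
      rw [integral_const_mul, integral_one_sub_cos_div_norm_rpow hs]
      ring
    simp_rw [hn]
    exact (integrable_fourier_mul_norm_rpow hs (𝓕 g)).const_mul _
  -- Adding the reflected integral cancels the odd cutoff kernel.
  have hsym : 2 * ∫ v, R v = ∫ v, ∫ η, F η * (k η v : ℂ) := by
    have hneg : Integrable fun v => R (-v) := hRi.comp_neg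
    rw [two_mul]
    nth_rewrite 2 [← integral_neg_eq_self]
    rw [← integral_add hRi hneg]
    refine integral_congr_ae (Eventually.of_forall fun v => ?_)
    have h1 : R v + R (-v) = ((g z - g (z + v)) + (g z - g (z + -v))) /
        ((‖v‖ ^ ((n : ℝ) + 2 * s) : ℝ) : ℂ) := by
      simp only [hR, cutoffKernel_neg, norm_neg]
      ring
    simp only
    rw [h1, two_mul_sub_sub_eq_integral_fourier, ← integral_div]
    refine integral_congr_ae (Eventually.of_forall fun η => ?_)
    simp only [hF, hk, Complex.ofReal_div]
    ring
  have hswap := integral_integral_swap hprod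
  have hinner : ∀ η, ∫ v, F η * (k η v : ℂ) =
      2 / (fracLaplacianConst n s : ℂ) *
      (Complex.exp (Complex.I * ((inner ℝ ((2 * Real.pi) • η) z : ℝ) : ℂ)) *
      (((‖(2 * Real.pi) • η‖ ^ (2 * s) : ℝ) : ℂ) * (𝓕 g) η)) := fun η => by
    rw [integral_const_mul, integral_complex_ofReal, integral_one_sub_cos_div_norm_rpow hs]
    simp only [hF, Complex.ofReal_div]
    ring
  simp_rw [hinner] at hswap
  rw [integral_const_mul, ← hsym] at hswap
  have hcc : (fracLaplacianConst n s : ℂ) ≠ 0 := by exact_mod_cast hc.ne'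
  rw [div_mul_eq_mul_div, div_eq_iff hcc] at hswap
  linear_combination hswap / 2

/-! ### Transport along `φ`. -/

/-- Change of variables `u = φ y`; `𝓕` has phase `e^(-2πi u·η)`, whence the rescaled frequency `η =
ξ / 2π`. -/
theorem weightedFourier_eq_fourier (φ : 𝔼 ≃ 𝔼) (hφ : Differentiable ℝ φ) (w f : 𝔼 → ℂ)
    (g : 𝓢(𝔼, ℂ)) (hg : ∀ y, g (φ y) = w y * f y) (ξ : 𝔼) :
    weightedFourier φ w f ξ = 1 / (((2 * Real.pi) ^ ((n : ℝ) / 2) : ℝ) : ℂ) *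
      (𝓕 g) ((2 * Real.pi)⁻¹ • ξ) := by
  unfold weightedFourier
  congr 1
  rw [SchwartzMap.fourier_coe, Real.fourier_eq']
  have h := integral_image_eq_integral_abs_det_fderiv_smul volume MeasurableSet.univ
    (fun y _ => (hφ y).hasFDerivAt.hasFDerivWithinAt) φ.injective.injOn
    (fun u : 𝔼 => Complex.exp (((-2 * Real.pi * inner ℝ u ((2 * Real.pi)⁻¹ • ξ) : ℝ) : ℂ) *
      Complex.I) • g u)
  rw [Set.image_univ, φ.surjective.range_eq, setIntegral_univ, setIntegral_univ] at h
  rw [h]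
  refine integral_congr_ae (Eventually.of_forall fun y => ?_)
  have he : -2 * Real.pi * inner ℝ (φ y) ((2 * Real.pi)⁻¹ • ξ) = -inner ℝ ξ (φ y) := by
    rw [inner_smul_right, real_inner_comm]
    have := Real.pi_pos.ne'
    field_simp
  simp only [he, hg, smul_eq_mul, Complex.real_smul, absJacobian, Complex.ofReal_neg]
  rw [show -(inner ℝ ξ (φ y) : ℂ) * Complex.I = -Complex.I * (inner ℝ ξ (φ y) : ℂ) by ring]
  ring

theorem weightedFracLaplacian_eq {s : ℝ} (hs : s ∈ Set.Ioo (0 : ℝ) 1) (φ : 𝔼 ≃ 𝔼)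
    (hφ : Differentiable ℝ φ) (w f : 𝔼 → ℂ) (g : 𝓢(𝔼, ℂ)) (hg : ∀ y, g (φ y) = w y * f y)
    (x : 𝔼) :
    weightedFracLaplacian s φ w f x = (fracLaplacianConst n s : ℂ) / w x *
      ∫ v, ((g (φ x) - g (φ x + v)) / ((‖v‖ ^ ((n : ℝ) + 2 * s) : ℝ) : ℂ) -
        cutoffKernel s (-fderiv ℝ g (φ x)) v) := by
  have hpi : 0 < 2 * Real.pi := by positivity
  set c : ℝ := (2 * Real.pi) ^ ((n : ℝ) / 2) with hc
  have hcn : c * c = (2 * Real.pi) ^ n := by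
    rw [hc, ← Real.rpow_add hpi, add_halves, Real.rpow_natCast]
  have hcc : (c : ℂ) * c = (2 * Real.pi : ℂ) ^ n := by exact_mod_cast hcn
  have hc0 : (c : ℂ) ≠ 0 := by exact_mod_cast (Real.rpow_pos_of_pos hpi _).ne'
  have hmain := integral_norm_rpow_mul_fourier hs g (φ x)
  -- Substituting `ξ = 2πη` yields a factor `(2π)^n = c * c`, which cancels the two prefactors `1 /
  -- c`.
  have hscale := Measure.integral_comp_smul (volume : Measure 𝔼)
    (fun ξ => Complex.exp (Complex.I * ((inner ℝ ξ (φ x) : ℝ) : ℂ)) *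
      (((‖ξ‖ ^ (2 * s) : ℝ) : ℂ) * weightedFourier φ w f ξ)) (2 * Real.pi)
  have hF : ∀ η : 𝔼, weightedFourier φ w f ((2 * Real.pi) • η) = 1 / (c : ℂ) * (𝓕 g) η := by
    intro η
    rw [weightedFourier_eq_fourier φ hφ w f g hg, smul_smul, inv_mul_cancel₀ hpi.ne', one_smul]
  have hL : ∀ η : 𝔼, Complex.exp (Complex.I * ((inner ℝ ((2 * Real.pi) • η) (φ x) : ℝ) : ℂ)) *
      (((‖(2 * Real.pi) • η‖ ^ (2 * s) : ℝ) : ℂ) * (1 / (c : ℂ) * (𝓕 g) η)) =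
      1 / (c : ℂ) * (Complex.exp (Complex.I * ((inner ℝ ((2 * Real.pi) • η) (φ x) : ℝ) : ℂ)) *
      (((‖(2 * Real.pi) • η‖ ^ (2 * s) : ℝ) : ℂ) * (𝓕 g) η)) := fun η => by ring
  simp only [hF, hL] at hscale
  rw [integral_const_mul, hmain, finrank_euclideanSpace, Fintype.card_fin,
    abs_of_nonneg (by positivity), ← hcn, Complex.real_smul] at hscale
  unfold weightedFracLaplacian weightedFourierInv
  rw [← hc]
  rcases eq_or_ne (w x) 0 with hw | hw
  · simp [hw]
  push_cast at hscale
  rw [div_mul_eq_mul_div, div_eq_iff hc0, mul_inv] at hscale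
  rw [one_mul] at hscale
  rw [div_mul_eq_mul_div, div_mul_eq_mul_div, hscale, one_mul]
  field_simp

/-- The map `y ↦ φ y - φ x` absorbs the Jacobian and carries `{ε < d y}` onto `{ε < ‖ψ v‖}`; `ψ`
records the chosen distance in the new variable, so one argument serves both kinds of region. -/
theorem hasPrincipalValue_hypersingularIntegrand {s : ℝ} (hs : s ∈ Set.Ioo (0 : ℝ) 1) (φ : 𝔼 ≃ 𝔼)
    (hφ : Differentiable ℝ φ) (w f : 𝔼 → ℂ) (g : 𝓢(𝔼, ℂ)) (hg : ∀ y, g (φ y) = w y * f y)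
    (x : 𝔼) {ψ : 𝔼 → 𝔼} (hψm : Measurable ψ) (A : 𝔼 ≃L[ℝ] 𝔼) {C : ℝ} (hC : 0 ≤ C)
    (hψ : ∀ v, ‖v‖ ≤ 1 → ‖ψ v - A v‖ ≤ C * ‖v‖ ^ 2)
    (hδ : ∀ r > 0, ∃ δ > 0, ∀ v, r ≤ ‖v‖ → δ ≤ ‖ψ v‖)
    {d : 𝔼 → ℝ} (hd : ∀ y, d y = ‖ψ (φ y - φ x)‖) :
    HasPrincipalValue d (hypersingularIntegrand s φ w f x)
      (∫ v, ((g (φ x) - g (φ x + v)) / ((‖v‖ ^ ((n : ℝ) + 2 * s) : ℝ) : ℂ) -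
        cutoffKernel s (-fderiv ℝ g (φ x)) v)) := by
  set K : 𝔼 → ℂ := fun v =>
    (g (φ x) - g (φ x + v)) / ((‖v‖ ^ ((n : ℝ) + 2 * s) : ℝ) : ℂ) with hK
  obtain ⟨hint, hlim⟩ := tendsto_setIntegral_of_sub_cutoffKernel hs (-fderiv ℝ g (φ x)) (K := K)
    (integrable_sub_cutoffKernel hs g (φ x)) (by simp [hK]) hψm A hC hψ hδ
  have hinj : Function.Injective fun y => φ y - φ x := fun a b h =>
    φ.injective (sub_left_injective h)
  have hset : ∀ ε : ℝ, (fun y => φ y - φ x) '' {y | ε < d y} = {v | ε < ‖ψ v‖} := by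
    intro ε
    ext v
    constructor
    · rintro ⟨y, hy, rfl⟩
      have hy : ε < d y := hy
      rwa [hd] at hy
    · intro hv
      refine ⟨φ.symm (φ x + v), ?_, by simp⟩
      simpa [hd] using hv
  have hmeas : ∀ ε : ℝ, MeasurableSet {y | ε < d y} := fun ε => by
    simp only [hd]
    exact measurableSet_lt measurable_const
      (hψm.comp (hφ.continuous.sub continuous_const).measurable).norm
  have hder : ∀ ε : ℝ, ∀ y ∈ {y | ε < d y},
      HasFDerivWithinAt (fun y => φ y - φ x) (fderiv ℝ φ y) {y | ε < d y} y := fun ε y _ =>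
    ((hφ y).hasFDerivAt.sub_const _).hasFDerivWithinAt
  have hH : hypersingularIntegrand s φ w f x =
      fun y => |(fderiv ℝ φ y).det| • K (φ y - φ x) := by
    funext y
    simp only [hypersingularIntegrand, hK, absJacobian, add_sub_cancel, hg, Complex.real_smul,
      norm_sub_rev (φ x)]
    ring
  rw [hH]
  refine ⟨fun ε hε => ?_, ?_⟩
  · rw [← integrableOn_image_iff_integrableOn_abs_det_fderiv_smul volume (hmeas ε) (hder ε)
      hinj.injOn K, hset]
    exact hint ε hε
  · refine hlim.congr fun ε => ?_
    rw [← hset ε, integral_image_eq_integral_abs_det_fderiv_smul volume (hmeas ε) (hder ε)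
      hinj.injOn K]

end WeightedFractional

theorem mainTheorem7 (n : ℕ) (s : ℝ) (hs : s ∈ Set.Ioo (0 : ℝ) 1)
    (φ : EuclideanSpace ℝ (Fin n) ≃ EuclideanSpace ℝ (Fin n))
    (hφ : ContDiff ℝ ∞ φ) (hφ_symm : ContDiff ℝ ∞ φ.symm)
    (w : EuclideanSpace ℝ (Fin n) → ℂ) (hw : ContDiff ℝ ∞ w) (hw_ne : ∀ x, w x ≠ 0)
    (f : EuclideanSpace ℝ (Fin n) → ℂ) (hf : f ∈ WeightedFractional.weightedSchwartz φ w)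
    (x : EuclideanSpace ℝ (Fin n)) :
    ∃ L : ℂ,
      WeightedFractional.HasPrincipalValue (fun y => ‖x - y‖)
        (WeightedFractional.hypersingularIntegrand s φ w f x) L ∧
      WeightedFractional.HasPrincipalValue (fun y => ‖φ x - φ y‖)
        (WeightedFractional.hypersingularIntegrand s φ w f x) L ∧
      WeightedFractional.weightedFracLaplacian s φ w f x =
        (WeightedFractional.fracLaplacianConst n s : ℂ) / w x * L := by
  obtain ⟨g, hg⟩ := hf
  have hg' : ∀ y, g (φ y) = w y * f y := fun y => by simp [hg]
  have hφd : Differentiable ℝ φ := hφ.differentiable (by simp)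
  have hφd' : Differentiable ℝ φ.symm := hφ_symm.differentiable (by simp)
  -- Unification takes `L` to be the absolutely convergent integral with the cutoff kernel
  -- subtracted.
  refine ⟨_, ?_, ?_, WeightedFractional.weightedFracLaplacian_eq hs φ hφd w f g hg' x⟩
  · obtain ⟨C, hC, hT⟩ := WeightedFractional.exists_norm_sub_fderiv_le_sq
      (contDiff_infty.1 hφ_symm 2) (φ x)
    have h1 : (fderiv ℝ φ.symm (φ x)).comp (fderiv ℝ φ x) = ContinuousLinearMap.id ℝ _ := by
      rw [← fderiv_comp x (hφd' _) (hφd x), φ.symm_comp_self, fderiv_id]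
    have h2 : (fderiv ℝ φ x).comp (fderiv ℝ φ.symm (φ x)) = ContinuousLinearMap.id ℝ _ := by
      have h := fderiv_comp (φ x) (hφd (φ.symm (φ x))) (hφd' (φ x))
      rw [φ.self_comp_symm, fderiv_id, φ.symm_apply_apply] at h
      exact h.symm
    -- With this `ψ`, `ψ (φ y - φ x) = y - x`; its linear part is the derivative of `φ.symm` at `φ
    -- x`, invertible by the chain rule.
    refine WeightedFractional.hasPrincipalValue_hypersingularIntegrand hs φ hφd w f g hg' x
      (ψ := fun v => φ.symm (φ x + v) - x)
      (by have := hφd'.continuous; exact (by fun_prop : Continuous _).measurable)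
      (ContinuousLinearEquiv.equivOfInverse (fderiv ℝ φ.symm (φ x)) (fderiv ℝ φ x)
        (fun v => DFunLike.congr_fun h2 v) (fun v => DFunLike.congr_fun h1 v))
      hC (fun v hv => by have h := hT v hv; rw [φ.symm_apply_apply] at h; exact h) (fun r hr => ?_)
      (fun y => by simp [norm_sub_rev])
    -- Continuity of `φ` at `x`: if `‖ψ v‖ < δ`, then `‖v‖ < r`.
    obtain ⟨δ, hδ, h⟩ := Metric.continuousAt_iff.1 hφd.continuous.continuousAt r hr
    refine ⟨δ, hδ, fun v hv => ?_⟩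
    by_contra hcon
    have := @h (φ.symm (φ x + v)) (by simpa [dist_eq_norm] using hcon)
    simp only [Equiv.apply_symm_apply, dist_eq_norm, add_sub_cancel_left] at this
    linarith
  · exact WeightedFractional.hasPrincipalValue_hypersingularIntegrand hs φ hφd w f g hg' x
      (ψ := id) measurable_id (ContinuousLinearEquiv.refl ℝ _) le_rfl (fun v _ => by simp)
      (fun r hr => ⟨r, hr, fun v hv => hv⟩) (fun y => by simp [norm_sub_rev])
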